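/- Let $G$ be a graph, i.e. a finite connected CW complex of dimension at most $1$ (loops and multiple edges allowed), and for $n \ge 0$ let $\mathrm{Conf}_n(G) = \{(x_1,\dots,x_n)\in G^n : x_i\ne x_j \text{ for } i\ne j\}$ with the subspace topology of $G^n$. An identifying function is a continuous map $f:\mathrm{Conf}_n(G)\to G$ with $f(x_1,\dots,x_n)\neq x_j$ for every $(x_1,\dots,x_n)\in\mathrm{Conf}_n(G)$ and every $j$. A section is a continuous map $s:\mathrm{Conf}_n(G)\to \mathrm{Conf}_{n+1}(G)$ with $\phi\circ s=\mathrm{id}$, where $\phi(x_1,\dots,x_{n+1})=(x_1,\dots,x_n)$. A connected component $C$ of $G\setminus\{w\}$ is said to be connected to the vertex $w$ at least twice if at least two ends at $w$ of edges of $G$ belong to edges whose interior lies in $C$ (a loop at $w$ has two ends at $w$). Suppose that $G$ has a vertex $w$ such that at least $k$ connected components of $G\setminus\{w\}$ are connected to $w$ at least twice. Then for every $n\le k$ there is an identifying function $\mathrm{Conf}_n(G)\to G$, and hence a section $\mathrm{Conf}_n(G)\to\mathrm{Conf}_{n+1}(G)$. -/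

import Mathlib

open Set Metric Topology

namespace GraphConf

/-- The `n`-th ordered configuration space, with the subspace topology of the product `X ^ n`. -/
abbrev Conf (n : ℕ) (X : Type*) : Type _ := {x : Fin n → X // Function.Injective x}

/-- The forgetting map `(x₁, …, xₙ₊₁) ↦ (x₁, …, xₙ)`. -/
def forget (n : ℕ) (X : Type*) (x : Conf (n + 1) X) : Conf n X :=
  ⟨fun i => x.1 i.castSucc, x.2.comp (Fin.castSucc_injective n)⟩

/-- A section of the forgetting map. -/
def IsSection (n : ℕ) (X : Type*) [TopologicalSpace X] (s : Conf n X → Conf (n + 1) X) : Prop :=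
  Continuous s ∧ forget n X ∘ s = id

/-- An identifying function: a continuous map whose value differs from every token of the
configuration. -/
def IsIdentifyingFunction (n : ℕ) (X : Type*) [TopologicalSpace X] (f : Conf n X → X) : Prop :=
  Continuous f ∧ ∀ (x : Conf n X) (j : Fin n), f x ≠ x.1 j

section Graph

variable (G : Type*) [TopologicalSpace G] [CWComplex (univ : Set G)]

/-- A graph: a finite connected Hausdorff CW complex without cells of dimension at least two. -/
structure IsGraph : Prop where
  t2 : T2Space G
  connected : ConnectedSpace G
  finite : CWComplex.Finite (univ : Set G)
  dim_le_one : ∀ m : ℕ, 2 ≤ m → IsEmpty (RelCWComplex.cell (univ : Set G) m)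

variable {G}

/-- `w` is a vertex, that is, the point of a zero-cell. -/
def IsVertex (w : G) : Prop :=
  ∃ v : RelCWComplex.cell (univ : Set G) 0, RelCWComplex.closedCell 0 v = {w}

/-- The ends at `w` of edges running in `C`. An edge `e` has the two ends `(e, -1)` and `(e, 1)`,
the points of `sphere 0 1` in `Fin 1 → ℝ`; so a loop at `w` has two ends at `w`. -/
def edgeEnds (w : G) (C : Set G) : Set (RelCWComplex.cell (univ : Set G) 1 × (Fin 1 → ℝ)) :=
  {p | p.2 ∈ sphere (0 : Fin 1 → ℝ) 1 ∧ RelCWComplex.map 1 p.1 p.2 = w ∧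
    RelCWComplex.openCell 1 p.1 ⊆ C}

/-- The connected components of `G ∖ w` which are connected to `w` at least twice. -/
def doublyAttachedComponents (w : G) : Set (Set G) :=
  {C | (∃ x ∈ ({w}ᶜ : Set G), C = connectedComponentIn {w}ᶜ x) ∧ 2 ≤ (edgeEnds w C).encard}

end Graph

end GraphConf

/-!
Let `D₁, …, Dₙ` be distinct components of `G ∖ {w}` attached to `w` at least twice. From the
midpoint of an edge end of `Dᵢ` at `w` there are two routes back to `w`: along that half edge, or
through the rest of `Dᵢ` and in along another end. Whatever the position of a single token in `Dᵢ`,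
one of them avoids it.

The new point waits at `w` unless one token is much closer to `w` than the others. The remaining
`n - 1` tokens then miss some `Dᵢ`, and as the close token approaches `w`, the new point withdraws
to the midpoint in `Dᵢ` along a route which that token does not block. The choice of the route
changes only when the token passes the midpoint or `w`, and at those moments the new point stands
at `w` or at the midpoint, respectively.
-/

namespace GraphConf

open RelCWComplex

section Topology

variable {X Y : Type*} [TopologicalSpace X] [TopologicalSpace Y]

theorem eventually_mem_iff_of_notMem_frontier {A : Set X} {x : X} (hx : x ∉ frontier A) :
    ∀ᶠ y in 𝓝 x, (y ∈ A ↔ x ∈ A) := by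
  by_cases hxA : x ∈ A
  · filter_upwards [mem_interior_iff_mem_nhds.1 ((mem_interior_iff_notMem_frontier hxA).2 hx)]
      with y hy
    exact iff_of_true hy hxA
  · rw [← frontier_compl] at hx
    filter_upwards [mem_interior_iff_mem_nhds.1
      ((mem_interior_iff_notMem_frontier (mem_compl hxA)).2 hx)] with y hy
    exact iff_of_false hy hxA

theorem subset_of_isPreconnected_of_disjoint_frontier {S P : Set X} (hS : IsPreconnected S)
    (hSP : (S ∩ P).Nonempty) (hfr : Disjoint S (frontier P)) : S ⊆ P := by
  have hint : ∀ x ∈ S, x ∈ P → x ∈ interior P := fun x hxS hxP =>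
    (mem_interior_iff_notMem_frontier hxP).2 (disjoint_left.1 hfr hxS)
  refine (hS.subset_of_closure_inter_subset isOpen_interior ?_ ?_).trans interior_subset
  · exact hSP.imp fun x hx => ⟨hx.1, hint x hx.1 hx.2⟩
  · rintro x ⟨hx, hxS⟩
    by_contra hxP
    exact disjoint_left.1 hfr hxS ⟨closure_mono interior_subset hx, hxP⟩

-- Collapsing `A` to `p` maps a path in `C` to a path in `C \ A`.
theorem joinedIn_diff_of_inter_frontier_subset_singleton {A C : Set X} {p q : X}
    (hpq : JoinedIn C p q) (hp : p ∉ A) (hq : q ∉ A) (hA : C ∩ frontier A ⊆ {p}) :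
    JoinedIn (C \ A) p q := by
  classical
  let collapse : X → X := A.piecewise (fun _ => p) id
  have hcont : ContinuousOn collapse C :=
    ContinuousOn.piecewise (fun x hx => (hA hx).symm) continuousOn_const continuousOn_id
  have hmaps : collapse '' C ⊆ C \ A := by
    rintro _ ⟨x, hx, rfl⟩
    by_cases hxA : x ∈ A
    · simpa [collapse, hxA] using And.intro hpq.source_mem hp
    · simpa [collapse, hxA] using hx
  simpa [collapse, hp, hq] using (hpq.map_continuousOn hcont).mono hmaps

theorem exists_continuous_selection {ι : Type*} [Finite ι] {F : ι → Y → X}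
    (hF : ∀ i, Continuous (F i)) {σ : Y → Set ι} {w : X}
    (hσ : ∀ y, (∀ i, F i y = w) ∨ ∀ᶠ z in 𝓝 y, σ z = σ y) :
    ∃ f : Y → X, Continuous f ∧ ∀ y, (σ y = ∅ ∧ f y = w) ∨ ∃ i ∈ σ y, f y = F i y := by
  classical
  let choice (S : Set ι) (y : Y) : X := if h : S.Nonempty then F h.some y else w
  refine ⟨fun y => choice (σ y) y, continuous_iff_continuousAt.2 fun y => ?_, fun y => ?_⟩
  · rcases hσ y with hw | hconst
    · have hy (S) : choice S y = w := by
        simp only [choice, hw, dite_eq_ite, ite_self]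
      rw [ContinuousAt, hy]
      refine fun N hN => Filter.mem_map.2 ?_
      have hev : ∀ᶠ z in 𝓝 y, ∀ i, F i z ∈ N := Filter.eventually_all.2 fun i =>
        (hF i).continuousAt.eventually_mem (by rwa [hw i])
      filter_upwards [hev] with z hz
      by_cases h : (σ z).Nonempty
      · simpa [choice, h] using hz _
      · simpa [choice, h] using mem_of_mem_nhds hN
    · have hcont : Continuous (choice (σ y)) := by
        by_cases h : (σ y).Nonempty
        · simpa [choice, h] using hF _
        · simpa [choice, h] using continuous_const
      refine hcont.continuousAt.congr ?_
      filter_upwards [hconst] with z hz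
      rw [hz]
  · by_cases h : (σ y).Nonempty
    · exact Or.inr ⟨h.some, h.some_mem, by simp [choice, h]⟩
    · exact Or.inl ⟨not_nonempty_iff_eq_empty.1 h, by simp [choice, h]⟩

end Topology

theorem exists_forall_ne_notMem_of_pairwise_disjoint {ι X : Type*} [Finite ι] {D : ι → Set X}
    (hD : Pairwise (Function.onFun Disjoint D)) (x : ι → X) (j : ι) :
    ∃ i, ∀ l, l ≠ j → x l ∉ D i := by
  by_contra! h
  choose token token_ne token_mem using h
  have hinj : Function.Injective token := fun a b hab => by
    by_contra hne
    exact disjoint_left.1 (hD hne) (token_mem a) (hab ▸ token_mem b)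
  obtain ⟨i, hi⟩ := Finite.injective_iff_surjective.1 hinj j
  exact token_ne i hi

/-- Two ways of moving from `base` to `w` in `insert w D`: `joinedIn_retreat` runs along `arm`,
and `joinedIn_escape` avoids it. Together they evade a token in `D`. Only the existence of the two
paths is recorded. -/
structure EvasionLoop {X : Type*} [TopologicalSpace X] (w : X) (D : Set X) where
  base : X
  arm : Set X
  arm_subset : arm ⊆ D
  frontier_arm_subset : frontier arm ⊆ {base, w}
  joinedIn_escape : JoinedIn (insert w D \ arm) base w
  joinedIn_retreat : JoinedIn (insert w (insert base arm)) base w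

namespace EvasionLoop

variable {X : Type*} [TopologicalSpace X] {w : X} {D : Set X} (L : EvasionLoop w D)

open Classical in
/-- The point that evades a token at `z`: it moves from the base at time `0` to `w` at time `1`,
along the arm unless the token is there. -/
noncomputable def evade (z : X) (t : ℝ) : X :=
  if z ∈ L.arm then L.joinedIn_escape.somePath.extend t else L.joinedIn_retreat.somePath.extend t

theorem evade_of_nonpos (z : X) {t : ℝ} (ht : t ≤ 0) : L.evade z t = L.base := by
  simp only [evade, Path.extend_of_le_zero _ ht, ite_self]

theorem evade_of_one_le (z : X) {t : ℝ} (ht : 1 ≤ t) : L.evade z t = w := by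
  simp only [evade, Path.extend_of_one_le _ ht, ite_self]

theorem insert_base_arm_subset : insert w (insert L.base L.arm) ⊆ insert w D :=
  insert_subset (mem_insert w D) <|
    insert_subset L.joinedIn_escape.source_mem.1 (L.arm_subset.trans (subset_insert w D))

theorem evade_mem (z : X) (t : ℝ) : L.evade z t ∈ insert w D := by
  unfold evade
  split_ifs
  · exact (L.joinedIn_escape.somePath_mem _).1
  · exact L.insert_base_arm_subset (L.joinedIn_retreat.somePath_mem _)

theorem evade_ne {z : X} (hzw : z ≠ w) (hzb : z ≠ L.base) (t : ℝ) : L.evade z t ≠ z := by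
  unfold evade
  split_ifs with hz
  · exact fun h => (L.joinedIn_escape.somePath_mem _).2 (mem_of_eq_of_mem h hz)
  · intro h
    have hmem : z ∈ insert w (insert L.base L.arm) :=
      mem_of_eq_of_mem h.symm (L.joinedIn_retreat.somePath_mem _)
    simp [hzw, hzb, hz] at hmem

theorem continuous_evade {Y : Type*} [TopologicalSpace Y] {z : Y → X} {t : Y → ℝ}
    (hz : Continuous z) (ht : Continuous t)
    (h : ∀ y, z y ∈ frontier L.arm → t y ≤ 0 ∨ 1 ≤ t y) :
    Continuous fun y => L.evade (z y) (t y) := by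
  classical
  refine Continuous.if (fun y hy => ?_) (by fun_prop) (by fun_prop)
  rcases h y (hz.frontier_preimage_subset _ hy) with ht | ht
  · simp only [Path.extend_of_le_zero _ ht]
  · simp only [Path.extend_of_one_le _ ht]

end EvasionLoop

section Phase

variable {X : Type*} [TopologicalSpace X] {n : ℕ} (d : C(X, unitInterval))

/-- How far the tokens other than `j` stay from the zero set of `d`. -/
noncomputable def clearance (j : Fin n) (x : Conf n X) : ℝ :=
  ∏ l ∈ Finset.univ.erase j, (d (x.1 l) : ℝ)

/-- The time at which token `j` is to be evaded: `0` when it lies in the zero set of `d`, and less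
than `1` only when it is the token closest to that set. -/
noncomputable def phase (j : Fin n) (x : Conf n X) : ℝ :=
  2 * d (x.1 j) / (clearance d j x + d (x.1 j))

theorem continuous_token (l : Fin n) : Continuous fun x : Conf n X => x.1 l :=
  (continuous_apply l).comp continuous_subtype_val

theorem continuous_clearance (j : Fin n) : Continuous (clearance d j) :=
  continuous_finsetProd _ fun l _ =>
    continuous_subtype_val.comp (d.continuous.comp (continuous_token l))

section

variable (x : Conf n X)

theorem clearance_nonneg (j : Fin n) : 0 ≤ clearance d j x :=
  Finset.prod_nonneg fun _ _ => unitInterval.nonneg _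

theorem clearance_le_one (j : Fin n) : clearance d j x ≤ 1 :=
  Finset.prod_le_one (fun _ _ => unitInterval.nonneg _) fun _ _ => unitInterval.le_one _

theorem clearance_le {j l : Fin n} (hl : l ≠ j) : clearance d j x ≤ d (x.1 l) := by
  rw [clearance, ← Finset.mul_prod_erase _ _ (Finset.mem_erase.2 ⟨hl, Finset.mem_univ l⟩)]
  exact mul_le_of_le_one_right (unitInterval.nonneg _)
    (Finset.prod_le_one (fun _ _ => unitInterval.nonneg _) fun _ _ => unitInterval.le_one _)

theorem phase_eq_zero {j : Fin n} (hj : d (x.1 j) = 0) : phase d j x = 0 := by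
  simp [phase, hj]

end

variable {d} {w : X} (hd : ∀ x, d x = 0 ↔ x = w)

include hd

theorem clearance_add_pos (j : Fin n) (x : Conf n X) : 0 < clearance d j x + d (x.1 j) := by
  have pos_of_ne {y : X} (hy : y ≠ w) : 0 < (d y : ℝ) := by
    rwa [unitInterval.coe_pos, unitInterval.pos_iff_ne_zero, ne_eq, hd]
  by_cases hj : x.1 j = w
  · refine add_pos_of_pos_of_nonneg (Finset.prod_pos fun l hl => pos_of_ne ?_)
      (unitInterval.nonneg _)
    rw [← hj]
    exact x.2.ne (Finset.ne_of_mem_erase hl)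
  · exact add_pos_of_nonneg_of_pos (clearance_nonneg d x j) (pos_of_ne hj)

theorem continuous_phase (j : Fin n) : Continuous (phase d j) := by
  have hj : Continuous fun x : Conf n X => (d (x.1 j) : ℝ) :=
    continuous_subtype_val.comp (d.continuous.comp (continuous_token j))
  exact (continuous_const.mul hj).div ((continuous_clearance d j).add hj)
    fun x => (clearance_add_pos hd j x).ne'

variable {x : Conf n X} {j : Fin n}

theorem phase_lt_one_iff : phase d j x < 1 ↔ d (x.1 j) < clearance d j x := by
  rw [phase, div_lt_one (clearance_add_pos hd j x)]
  constructor <;> intro h <;> linarith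

theorem one_le_phase (hj : d (x.1 j) = 1) : 1 ≤ phase d j x := by
  rw [← not_lt, phase_lt_one_iff hd, hj, not_lt]
  exact clearance_le_one d x j

theorem lt_of_phase_lt_one (hj : phase d j x < 1) {l : Fin n} (hl : l ≠ j) :
    d (x.1 j) < d (x.1 l) :=
  Subtype.coe_lt_coe.1 (((phase_lt_one_iff hd).1 hj).trans_le (clearance_le d x hl))

theorem eq_of_phase_lt_one {l : Fin n} (hj : phase d j x < 1) (hl : phase d l x < 1) : j = l := by
  by_contra hne
  exact lt_asymm (lt_of_phase_lt_one hd hj (Ne.symm hne)) (lt_of_phase_lt_one hd hl hne)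

theorem ne_of_phase_lt_one (hj : phase d j x < 1) {l : Fin n} (hl : l ≠ j) : x.1 l ≠ w :=
  (hd _).not.1 (unitInterval.nonneg'.trans_lt (lt_of_phase_lt_one hd hj hl)).ne'

end Phase

section Identifying

variable {X : Type*} [TopologicalSpace X] {n : ℕ}

theorem IsIdentifyingFunction.exists_isSection {f : Conf n X → X}
    (hf : IsIdentifyingFunction n X f) : ∃ s, IsSection n X s := by
  refine ⟨fun x => ⟨Fin.snoc (α := fun _ => X) x.1 (f x), ?_⟩, ?_, ?_⟩
  · rw [Fin.snoc_injective_iff]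
    exact ⟨x.2, fun ⟨j, hj⟩ => hf.2 x j hj.symm⟩
  · refine Continuous.subtype_mk (continuous_pi fun i => ?_) _
    induction i using Fin.lastCases with
    | last => simpa only [Fin.snoc_last] using hf.1
    | cast i => simpa only [Fin.snoc_castSucc] using continuous_token i
  · funext x
    ext i
    simp [forget]

variable {ι : Type*} (d : C(X, unitInterval)) (D : ι → Set X)

/-- The pairs of a token `j` that has to be evaded and a set `D i`, free of all other tokens, in
which this can be done. -/
def responses (x : Conf n X) : Set (Fin n × ι) :=
  {p | phase d p.1 x < 1 ∧ ∀ l, l ≠ p.1 → x.1 l ∉ D p.2}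

variable {d D} {w : X} (hd : ∀ x, d x = 0 ↔ x = w)

include hd

theorem eventually_responses_eq [Finite ι] (hDw : ∀ i, frontier (D i) ⊆ {w}) {x : Conf n X}
    {j : Fin n} (hj : phase d j x < 1) : ∀ᶠ y in 𝓝 x, responses d D y = responses d D x := by
  have hlt : ∀ᶠ y in 𝓝 x, phase d j y < 1 :=
    (continuous_phase hd j).continuousAt.eventually_lt_const hj
  have hmem : ∀ᶠ y in 𝓝 x, ∀ i l, l ≠ j → (y.1 l ∈ D i ↔ x.1 l ∈ D i) := by
    refine Filter.eventually_all.2 fun i => Filter.eventually_all.2 fun l => ?_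
    rw [Filter.eventually_imp_distrib_left]
    exact fun hl => (continuous_token l).continuousAt.eventually <|
      eventually_mem_iff_of_notMem_frontier fun h => ne_of_phase_lt_one hd hj hl (hDw i h)
  have responses_eq (y : Conf n X) (hy : phase d j y < 1) :
      responses d D y = {p | p.1 = j ∧ ∀ l, l ≠ j → y.1 l ∉ D p.2} := by
    ext p
    constructor
    · rintro ⟨hp, hfree⟩
      obtain rfl := eq_of_phase_lt_one hd hp hy
      exact ⟨rfl, hfree⟩
    · rintro ⟨rfl, hfree⟩
      exact ⟨hy, hfree⟩
  filter_upwards [hlt, hmem] with y hy hyx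
  rw [responses_eq y hy, responses_eq x hj]
  ext p
  exact and_congr_right' (forall₂_congr fun l hl => not_congr (hyx p.2 l hl))

theorem EvasionLoop.evade_phase_ne {p : Fin n × ι} (L : EvasionLoop w (D p.2))
    (hL : d L.base = 1) {x : Conf n X} (hp : p ∈ responses d D x) (l : Fin n) :
    L.evade (x.1 p.1) (phase d p.1 x) ≠ x.1 l := by
  by_cases hl : l = p.1
  · subst hl
    by_cases hlw : x.1 p.1 = w
    · rw [L.evade_of_nonpos _ (phase_eq_zero d x ((hd _).2 hlw)).le, hlw, ne_eq, ← hd, hL]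
      exact one_ne_zero
    · refine L.evade_ne hlw (fun hbase => hp.1.not_ge (one_le_phase hd ?_)) _
      rw [hbase, hL]
  · intro h
    rcases h ▸ L.evade_mem (x.1 p.1) (phase d p.1 x) with hw | hD
    · exact ne_of_phase_lt_one hd hp.1 hl hw
    · exact hp.2 l hl hD

theorem EvasionLoop.continuous_evade_phase {D : Set X} (L : EvasionLoop w D) (hL : d L.base = 1)
    (j : Fin n) : Continuous fun x : Conf n X => L.evade (x.1 j) (phase d j x) := by
  refine L.continuous_evade (continuous_token j) (continuous_phase hd j) fun x hx => ?_
  rcases L.frontier_arm_subset hx with h | h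
  · exact Or.inr (one_le_phase hd (by rw [h, hL]))
  · exact Or.inl (phase_eq_zero d x ((hd _).2 h)).le

theorem exists_isIdentifyingFunction {D : Fin n → Set X}
    (hD : Pairwise (Function.onFun Disjoint D)) (hDw : ∀ i, frontier (D i) ⊆ {w})
    (L : ∀ i, EvasionLoop w (D i)) (hL : ∀ i, d (L i).base = 1) :
    ∃ f, IsIdentifyingFunction n X f := by
  obtain ⟨f, hf, hfσ⟩ := exists_continuous_selection (σ := responses d D) (w := w)
    (fun p : Fin n × Fin n => (L p.2).continuous_evade_phase hd (hL p.2) p.1) fun x => by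
      by_cases h : ∃ j, phase d j x < 1
      · exact Or.inr (eventually_responses_eq hd hDw h.choose_spec)
      · exact Or.inl fun p => (L p.2).evade_of_one_le _ (not_lt.1 fun hp => h ⟨p.1, hp⟩)
  refine ⟨f, hf, fun x l => ?_⟩
  rcases hfσ x with ⟨hempty, hfw⟩ | ⟨p, hp, hfp⟩
  · rw [hfw]
    rintro rfl
    obtain ⟨i, hi⟩ := exists_forall_ne_notMem_of_pairwise_disjoint hD x.1 l
    have hl : (l, i) ∈ responses d D x :=
      ⟨(phase_eq_zero d x ((hd _).2 rfl)).trans_lt one_pos, hi⟩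
    exact notMem_empty _ (hempty ▸ hl)
  · rw [hfp]
    exact (L p.2).evade_phase_ne hd (hL p.2) hp l

end Identifying

section Cells

variable {G : Type*} [TopologicalSpace G] [CWComplex (univ : Set G)]

theorem IsVertex.notMem_openCell_one {w : G} (hw : IsVertex w) (e : cell (univ : Set G) 1) :
    w ∉ openCell 1 e := by
  obtain ⟨v, hv⟩ := hw
  rw [closedCell_zero_eq_singleton, ← openCell_zero_eq_singleton] at hv
  exact disjoint_left.1 (disjoint_openCell_of_ne (by simp)) (hv ▸ mem_singleton w)

theorem disjoint_cellFrontier_openCell_one (c e : cell (univ : Set G) 1) :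
    Disjoint (cellFrontier 1 c) (openCell 1 e) := by
  obtain ⟨u, v, h⟩ := CWComplex.exists_cellFrontier_one_eq c
  rw [h, closedCell_zero_eq_singleton, ← openCell_zero_eq_singleton,
    closedCell_zero_eq_singleton, ← openCell_zero_eq_singleton, disjoint_union_left]
  exact ⟨disjoint_openCell_of_ne (by simp), disjoint_openCell_of_ne (by simp)⟩

theorem disjoint_closedCell_openCell_one {c e : cell (univ : Set G) 1} (hce : c ≠ e) :
    Disjoint (closedCell 1 c) (openCell 1 e) := by
  rw [← cellFrontier_union_openCell_eq_closedCell, disjoint_union_left]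
  exact ⟨disjoint_cellFrontier_openCell_one c e, disjoint_openCell_of_ne (by simpa using hce)⟩

theorem eq_of_map_one_eq (e : cell (univ : Set G) 1) {a b : Fin 1 → ℝ} (ha : a ∈ closedBall 0 1)
    (hb : b ∈ ball 0 1) (h : map 1 e a = map 1 e b) : a = b := by
  rw [← sphere_union_ball] at ha
  rcases ha with ha | ha
  · exact (disjoint_left.1 (disjoint_cellFrontier_openCell_one e e) ⟨a, ha, rfl⟩
      ⟨b, hb, h.symm⟩).elim
  · exact (map 1 e).injOn (by rwa [source_eq]) (by rwa [source_eq]) h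

variable [T2Space G]

theorem isClosed_image_map {m : ℕ} (e : cell (univ : Set G) m) {K : Set (Fin m → ℝ)}
    (hK : IsClosed K) (hKb : K ⊆ closedBall 0 1) : IsClosed (map m e '' K) :=
  (((isCompact_closedBall 0 1).of_isClosed_subset hK hKb).image_of_continuousOn
    ((continuousOn m e).mono hKb)).isClosed

variable (hdim : ∀ m, 2 ≤ m → IsEmpty (cell (univ : Set G) m))

include hdim

theorem isClosed_of_forall_edge {A : Set G}
    (hA : ∀ e : cell (univ : Set G) 1, IsClosed (A ∩ closedCell 1 e)) : IsClosed A := by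
  refine CWComplex.isClosed_of_disjoint_openCell_or_isClosed_inter_closedCell (subset_univ A)
    fun m hm c => ?_
  obtain rfl | hm := (Nat.succ_le_of_lt hm).eq_or_lt
  · exact Or.inr (hA c)
  · exact ((hdim m hm).false c).elim

theorem isOpen_image_map_one (e : cell (univ : Set G) 1) {U : Set (Fin 1 → ℝ)} (hU : IsOpen U)
    (hUb : U ⊆ ball 0 1) : IsOpen (map 1 e '' U) := by
  rw [← isClosed_compl_iff]
  refine isClosed_of_forall_edge hdim fun c => ?_
  obtain rfl | hce := eq_or_ne c e
  · have hcompl : (map 1 c '' U)ᶜ ∩ closedCell 1 c = map 1 c '' (closedBall 0 1 \ U) := by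
      refine Subset.antisymm ?_ ?_
      · rintro _ ⟨hxU, b, hb, rfl⟩
        exact ⟨b, ⟨hb, fun hbU => hxU ⟨b, hbU, rfl⟩⟩, rfl⟩
      · rintro _ ⟨b, ⟨hb, hbU⟩, rfl⟩
        refine ⟨?_, b, hb, rfl⟩
        rintro ⟨a, ha, hab⟩
        exact hbU (eq_of_map_one_eq c hb (hUb ha) hab.symm ▸ ha)
    rw [hcompl]
    exact isClosed_image_map c (isClosed_closedBall.sdiff hU) sdiff_subset
  · have hsub : closedCell 1 c ⊆ (map 1 e '' U)ᶜ :=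
      ((disjoint_closedCell_openCell_one hce).mono_right (image_mono hUb)).subset_compl_right
    rw [inter_eq_right.2 hsub]
    exact isClosed_closedCell

theorem continuous_of_forall_edge {Z : Type*} [TopologicalSpace Z] {f : G → Z}
    (hf : ∀ e : cell (univ : Set G) 1, ContinuousOn (f ∘ map 1 e) (closedBall 0 1)) :
    Continuous f := by
  refine continuous_iff_isClosed.2 fun K hK => isClosed_of_forall_edge hdim fun e => ?_
  rw [inter_comm, closedCell, ← image_inter_preimage, ← preimage_comp]
  exact isClosed_image_map e ((hf e).preimage_isClosed_of_isClosed isClosed_closedBall hK)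
    inter_subset_left

theorem exists_continuous_eqOn_edges {Z : Type*} [TopologicalSpace Z] (v : G → Z)
    (g : cell (univ : Set G) 1 → (Fin 1 → ℝ) → Z)
    (hg : ∀ e, ContinuousOn (g e) (closedBall 0 1))
    (hgv : ∀ e : cell (univ : Set G) 1, ∀ s ∈ sphere (0 : Fin 1 → ℝ) 1, g e s = v (map 1 e s)) :
    ∃ f : C(G, Z), (∀ e, EqOn (f ∘ map 1 e) (g e) (closedBall 0 1)) ∧
      ∀ x, (∀ e : cell (univ : Set G) 1, x ∉ openCell 1 e) → f x = v x := by
  classical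
  let f (x : G) : Z :=
    if h : ∃ e : cell (univ : Set G) 1, x ∈ openCell 1 e then
      g h.choose ((map 1 h.choose).symm x)
    else v x
  have f_of_notMem (x : G) (hx : ∀ e : cell (univ : Set G) 1, x ∉ openCell 1 e) : f x = v x :=
    dif_neg (not_exists.2 hx)
  have f_eqOn (e : cell (univ : Set G) 1) : EqOn (f ∘ map 1 e) (g e) (closedBall 0 1) := by
    rw [← sphere_union_ball]
    rintro b (hb | hb)
    · rw [hgv e b hb]
      exact f_of_notMem _ fun c =>
        disjoint_left.1 (disjoint_cellFrontier_openCell_one e c) ⟨b, hb, rfl⟩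
    · have h : ∃ c : cell (univ : Set G) 1, map 1 e b ∈ openCell 1 c := ⟨e, b, hb, rfl⟩
      have hc : h.choose = e := by
        simpa using eq_of_not_disjoint_openCell
          (not_disjoint_iff.2 ⟨_, h.choose_spec, b, hb, rfl⟩)
      simp only [f, Function.comp_apply, dif_pos h]
      rw [hc, (map 1 e).left_inv (by rwa [source_eq])]
  exact ⟨⟨f, continuous_of_forall_edge hdim fun e => (hg e).congr (f_eqOn e)⟩, f_eqOn,
    f_of_notMem⟩

end Cells

theorem eq_or_eq_neg_of_norm_eq {a b : Fin 1 → ℝ} (h : ‖a‖ = ‖b‖) : a = b ∨ a = -b := by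
  have hab : a 0 = b 0 ∨ a 0 = -b 0 := abs_eq_abs.1 (by simpa [Pi.norm_def] using h)
  exact hab.imp (fun h => by ext i; rwa [Subsingleton.elim i 0])
    (fun h => by ext i; rwa [Subsingleton.elim i 0])

theorem finite_sphere_fin_one : (sphere (0 : Fin 1 → ℝ) 1).Finite :=
  (toFinite {1, -1}).subset fun _ hs =>
    eq_or_eq_neg_of_norm_eq ((mem_sphere_zero_iff_norm.1 hs).trans norm_one.symm)

theorem exists_continuous_eq_zero_iff_mem {M : Type*} [MetricSpace M] (S : Finset M) :
    ∃ φ : C(M, unitInterval), (∀ x, φ x = 0 ↔ x ∈ S) ∧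
      ∀ x, (∀ s ∈ S, 1 ≤ dist x s) → φ x = 1 := by
  let φ (x : M) : unitInterval := ∏ s ∈ S, projIcc 0 1 zero_le_one (dist x s)
  have hφ : Continuous φ := continuous_finsetProd _ fun s _ =>
    continuous_projIcc.comp (continuous_id.dist continuous_const)
  refine ⟨⟨φ, hφ⟩, fun x => ?_, fun x hx => ?_⟩
  · have hzero (s : M) : projIcc 0 1 zero_le_one (dist x s) = (0 : unitInterval) ↔ x = s :=
      (projIcc_eq_left zero_lt_one).trans dist_le_zero
    simp [φ, Finset.prod_eq_zero_iff, hzero]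
  · exact Finset.prod_eq_one fun s hs => (projIcc_eq_right zero_lt_one).2 (hx s hs)

theorem exists_continuous_eq_zero_iff {G : Type*} [TopologicalSpace G] [T2Space G]
    [CWComplex (univ : Set G)] (hdim : ∀ m, 2 ≤ m → IsEmpty (cell (univ : Set G) m)) {w : G}
    (hw : IsVertex w) : ∃ d : C(G, unitInterval), (∀ x, d x = 0 ↔ x = w) ∧
      ∀ e : cell (univ : Set G) 1, d (map 1 e 0) = 1 := by
  classical
  have hfin (e : cell (univ : Set G) 1) : {s ∈ sphere 0 1 | map 1 e s = w}.Finite :=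
    finite_sphere_fin_one.subset (sep_subset _ _)
  choose g hg0 hg1 using fun e => exists_continuous_eq_zero_iff_mem (hfin e).toFinset
  simp only [Finite.mem_toFinset, mem_ofPred_eq] at hg0 hg1
  have one_le_dist {a b : Fin 1 → ℝ} (ha : a ∈ sphere 0 1) (hb : b ∈ sphere 0 1) (hab : a ≠ b) :
      1 ≤ dist a b := by
    rw [mem_sphere_zero_iff_norm] at ha hb
    rw [(eq_or_eq_neg_of_norm_eq (hb.trans ha.symm)).resolve_left hab.symm, dist_eq_norm,
      sub_neg_eq_add, ← two_smul ℝ, norm_smul, ha]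
    norm_num
  obtain ⟨d, hd, hdv⟩ := exists_continuous_eqOn_edges hdim
    (fun x => if x = w then (0 : unitInterval) else 1) (fun e => g e)
    (fun e => (g e).continuous.continuousOn) fun e s hs => by
      split_ifs with h
      · exact (hg0 e s).2 ⟨hs, h⟩
      · exact hg1 e s fun t ht => one_le_dist hs ht.1 fun hst => h (hst ▸ ht.2)
  refine ⟨d, fun x => ?_, fun e => ?_⟩
  · by_cases hx : ∃ e : cell (univ : Set G) 1, x ∈ openCell 1 e
    · obtain ⟨e, b, hb, rfl⟩ := hx
      have hbw : map 1 e b ≠ w := fun h => hw.notMem_openCell_one e ⟨b, hb, h⟩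
      rw [← Function.comp_apply (f := d), hd e (ball_subset_closedBall hb), hg0]
      exact iff_of_false (fun h => hbw h.2) hbw
    · simp [hdv x (not_exists.1 hx)]
  · rw [← Function.comp_apply (f := d), hd e (mem_closedBall_self zero_le_one)]
    exact hg1 e 0 fun s hs => by rw [dist_comm, hs.1]

section Components

variable {G : Type*} [TopologicalSpace G] [CWComplex (univ : Set G)] {w : G}

theorem isPathConnected_closedCell_one_diff (hw : IsVertex w) (e : cell (univ : Set G) 1) :
    IsPathConnected (closedCell 1 e \ {w}) := by
  have map_ne {b : Fin 1 → ℝ} (hb : b ∈ ball 0 1) : map 1 e b ≠ w := fun h =>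
    hw.notMem_openCell_one e ⟨b, hb, h⟩
  have hstar : StarConvex ℝ 0 (closedBall (0 : Fin 1 → ℝ) 1 ∩ map 1 e ⁻¹' {w}ᶜ) := by
    rw [starConvex_zero_iff]
    rintro b ⟨hb, hbw⟩ t ht0 ht1
    rcases ht1.eq_or_lt with rfl | ht1
    · rw [one_smul]
      exact ⟨hb, hbw⟩
    · have htb : t • b ∈ ball (0 : Fin 1 → ℝ) 1 := by
        rw [mem_closedBall_zero_iff] at hb
        rw [mem_ball_zero_iff, norm_smul, Real.norm_of_nonneg ht0]
        exact (mul_le_of_le_one_right ht0 hb).trans_lt ht1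
      exact ⟨ball_subset_closedBall htb, map_ne htb⟩
  rw [sdiff_eq, closedCell, ← image_inter_preimage]
  exact (hstar.isPathConnected ⟨mem_closedBall_self zero_le_one,
    map_ne (mem_ball_self one_pos)⟩).image' ((continuousOn 1 e).mono inter_subset_left)

variable [T2Space G] (hdim : ∀ m, 2 ≤ m → IsEmpty (cell (univ : Set G) m))

include hdim

theorem isClosed_insert_of_forall_edge {P : Set G}
    (hP : ∀ e : cell (univ : Set G) 1, closedCell 1 e \ {w} ⊆ P ∨ closedCell 1 e \ {w} ⊆ Pᶜ) :
    IsClosed (insert w P) := by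
  refine isClosed_of_forall_edge hdim fun e => ?_
  rcases hP e with h | h
  · rw [inter_eq_right.2 (sdiff_singleton_subset_iff.1 h)]
    exact isClosed_closedCell
  · refine ((finite_singleton w).subset ?_).isClosed
    rintro x ⟨hx | hx, hxe⟩
    · exact hx
    · by_contra hxw
      exact h ⟨hxe, hxw⟩ hx

theorem frontier_subset_of_forall_edge {P : Set G}
    (hP : ∀ e : cell (univ : Set G) 1, closedCell 1 e \ {w} ⊆ P ∨ closedCell 1 e \ {w} ⊆ Pᶜ) :
    frontier P ⊆ {w} := by
  have hPc := isClosed_insert_of_forall_edge hdim (w := w) (P := Pᶜ) fun e => by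
    rw [compl_compl]
    exact (hP e).symm
  rw [frontier_eq_closure_inter_closure]
  rintro x ⟨hx, hxc⟩
  by_contra hxw
  exact (closure_minimal (subset_insert w _) hPc hxc).resolve_left hxw <|
    (closure_minimal (subset_insert w P) (isClosed_insert_of_forall_edge hdim hP) hx).resolve_left
      hxw

theorem frontier_pathComponentIn_subset (hw : IsVertex w) (x : G) :
    frontier (pathComponentIn {w}ᶜ x) ⊆ {w} := by
  refine frontier_subset_of_forall_edge hdim fun e => ?_
  have hpc := isPathConnected_closedCell_one_diff hw e
  rw [or_iff_not_imp_right, not_subset]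
  rintro ⟨y, hye, hy⟩
  rw [notMem_compl_iff] at hy
  rw [← pathComponentIn_congr hy]
  exact hpc.subset_pathComponentIn hye fun z hz => hz.2

theorem connectedComponentIn_eq_pathComponentIn (hw : IsVertex w) {x : G} (hx : x ≠ w) :
    connectedComponentIn {w}ᶜ x = pathComponentIn {w}ᶜ x := by
  refine Subset.antisymm ?_ ?_
  · refine subset_of_isPreconnected_of_disjoint_frontier isPreconnected_connectedComponentIn
      ⟨x, mem_connectedComponentIn hx, mem_pathComponentIn_self hx⟩ ?_
    exact ((disjoint_compl_left (a := {w})).mono_left (connectedComponentIn_subset _ x)).mono_right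
      (frontier_pathComponentIn_subset hdim hw x)
  · have hpc := isPathConnected_pathComponentIn (F := {w}ᶜ) hx
    exact hpc.isConnected.isPreconnected.subset_connectedComponentIn
      (mem_pathComponentIn_self hx) pathComponentIn_subset

end Components

section HalfEdges

variable {G : Type*} [TopologicalSpace G] [CWComplex (univ : Set G)]

/-- The half of the edge `e` that ends at `map 1 e s`, for `s ∈ sphere 0 1`, parametrized from the
midpoint of `e` at time `0` to that end at time `1`. -/
def halfEdge (e : cell (univ : Set G) 1) (s : Fin 1 → ℝ) (t : ℝ) : G :=
  map 1 e (t • s)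

theorem halfEdge_zero (e : cell (univ : Set G) 1) (s : Fin 1 → ℝ) :
    halfEdge e s 0 = map 1 e 0 := by
  rw [halfEdge, zero_smul]

theorem halfEdge_one (e : cell (univ : Set G) 1) (s : Fin 1 → ℝ) :
    halfEdge e s 1 = map 1 e s := by
  rw [halfEdge, one_smul]

theorem image_halfEdge_Icc (e : cell (univ : Set G) 1) (s : Fin 1 → ℝ) :
    halfEdge e s '' Icc 0 1 =
      insert (map 1 e s) (insert (map 1 e 0) (halfEdge e s '' Ioo 0 1)) := by
  rw [← Ico_insert_right zero_le_one, ← Ioo_insert_left zero_lt_one, image_insert_eq,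
    image_insert_eq, halfEdge_zero, halfEdge_one]

theorem smul_mem_closedBall_of_mem_sphere {E : Type*} [NormedAddCommGroup E] [NormedSpace ℝ E]
    {s : E} (hs : s ∈ sphere 0 1) {t : ℝ} (ht : t ∈ Icc (0 : ℝ) 1) : t • s ∈ closedBall 0 1 := by
  rw [mem_closedBall_zero_iff, norm_smul, mem_sphere_zero_iff_norm.1 hs, mul_one,
    Real.norm_of_nonneg ht.1]
  exact ht.2

theorem smul_mem_ball_of_mem_sphere {E : Type*} [NormedAddCommGroup E] [NormedSpace ℝ E]
    {s : E} (hs : s ∈ sphere 0 1) {t : ℝ} (ht : t ∈ Ico (0 : ℝ) 1) : t • s ∈ ball 0 1 := by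
  rw [mem_ball_zero_iff, norm_smul, mem_sphere_zero_iff_norm.1 hs, mul_one,
    Real.norm_of_nonneg ht.1]
  exact ht.2

variable {e : cell (univ : Set G) 1} {s : Fin 1 → ℝ} (hs : s ∈ sphere 0 1)

include hs

theorem continuousOn_halfEdge : ContinuousOn (halfEdge e s) (Icc 0 1) :=
  (continuousOn 1 e).comp (by fun_prop) fun _ ht => smul_mem_closedBall_of_mem_sphere hs ht

theorem image_halfEdge_Icc_subset_closedCell : halfEdge e s '' Icc 0 1 ⊆ closedCell 1 e :=
  image_subset_iff.2 fun _ ht => mem_image_of_mem _ (smul_mem_closedBall_of_mem_sphere hs ht)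

theorem image_halfEdge_Ioo_subset_openCell : halfEdge e s '' Ioo 0 1 ⊆ openCell 1 e :=
  image_subset_iff.2 fun _ ht =>
    mem_image_of_mem _ (smul_mem_ball_of_mem_sphere hs (Ioo_subset_Ico_self ht))

theorem map_zero_notMem_image_halfEdge_Ioo : map 1 e 0 ∉ halfEdge e s '' Ioo 0 1 := by
  rintro ⟨t, ht, h⟩
  have hts : (0 : Fin 1 → ℝ) = t • s := eq_of_map_one_eq e (mem_closedBall_self zero_le_one)
    (smul_mem_ball_of_mem_sphere hs (Ioo_subset_Ico_self ht)) h.symm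
  exact smul_ne_zero ht.1.ne' (ne_of_mem_sphere hs one_ne_zero) hts.symm

theorem disjoint_image_halfEdge_Icc_Ioo {e' : cell (univ : Set G) 1} {s' : Fin 1 → ℝ}
    (hs' : s' ∈ sphere 0 1) (hne : (e', s') ≠ (e, s)) :
    Disjoint (halfEdge e' s' '' Icc 0 1) (halfEdge e s '' Ioo 0 1) := by
  by_cases he : e' = e
  · subst he
    have hneg : s' = -s := (eq_or_eq_neg_of_norm_eq ((mem_sphere_zero_iff_norm.1 hs').trans
      (mem_sphere_zero_iff_norm.1 hs).symm)).resolve_left fun h => hne (by rw [h])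
    rw [disjoint_left]
    rintro _ ⟨t', ht', rfl⟩ ⟨t, ht, h⟩
    have hts : t' • s' = t • s := eq_of_map_one_eq e' (smul_mem_closedBall_of_mem_sphere hs' ht')
      (smul_mem_ball_of_mem_sphere hs (Ioo_subset_Ico_self ht)) h.symm
    rw [hneg, smul_neg, neg_eq_iff_add_eq_zero, ← add_smul] at hts
    exact smul_ne_zero (add_pos_of_nonneg_of_pos ht'.1 ht.1).ne' (ne_of_mem_sphere hs one_ne_zero)
      hts
  · exact ((disjoint_closedCell_openCell_one he).mono_left
      (image_halfEdge_Icc_subset_closedCell hs')).mono_right (image_halfEdge_Ioo_subset_openCell hs)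

variable [T2Space G] (hdim : ∀ m, 2 ≤ m → IsEmpty (cell (univ : Set G) m))

include hdim

theorem isOpen_image_halfEdge_Ioo : IsOpen (halfEdge e s '' Ioo 0 1) := by
  have hsurj : Function.Surjective (LinearMap.toSpanSingleton ℝ (Fin 1 → ℝ) s) :=
    exists_smul_eq_of_finrank_eq_one (by simp) (ne_of_mem_sphere hs one_ne_zero)
  have hopen : IsOpen ((fun t : ℝ => t • s) '' Ioo 0 1) :=
    LinearMap.isOpenMap_of_finiteDimensional _ hsurj _ isOpen_Ioo
  have himage : halfEdge e s '' Ioo 0 1 = map 1 e '' ((fun t : ℝ => t • s) '' Ioo 0 1) :=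
    image_comp _ _ _
  rw [himage]
  exact isOpen_image_map_one hdim e hopen <| image_subset_iff.2 fun _ ht =>
    smul_mem_ball_of_mem_sphere hs (Ioo_subset_Ico_self ht)

theorem frontier_image_halfEdge_Ioo_subset :
    frontier (halfEdge e s '' Ioo 0 1) ⊆ {map 1 e 0, map 1 e s} := by
  have hclosed : IsClosed (halfEdge e s '' Icc 0 1) :=
    (isCompact_Icc.image_of_continuousOn (continuousOn_halfEdge hs)).isClosed
  rw [(isOpen_image_halfEdge_Ioo hs hdim).frontier_eq, pair_comm]
  rintro x ⟨hx, hxU⟩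
  have hxI := closure_minimal (image_mono Ioo_subset_Icc_self) hclosed hx
  rw [image_halfEdge_Icc] at hxI
  exact hxI.imp_right fun h => h.resolve_right hxU

end HalfEdges

section DoublyAttached

variable {G : Type*} [TopologicalSpace G] [CWComplex (univ : Set G)] {w : G}

theorem pairwise_disjoint_doublyAttachedComponents :
    (doublyAttachedComponents w).PairwiseDisjoint id := by
  rintro _ ⟨⟨x, -, rfl⟩, -⟩ _ ⟨⟨y, -, rfl⟩, -⟩ hne
  by_contra h
  obtain ⟨z, hzx, hzy⟩ := not_disjoint_iff.1 h
  exact hne ((connectedComponentIn_eq hzx).trans (connectedComponentIn_eq hzy).symm)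

section

variable {C : Set G} {e : cell (univ : Set G) 1} {s : Fin 1 → ℝ} (h : (e, s) ∈ edgeEnds w C)

include h

theorem map_zero_mem_of_mem_edgeEnds : map 1 e 0 ∈ C :=
  h.2.2 ⟨0, mem_ball_self one_pos, rfl⟩

theorem image_halfEdge_Ioo_subset_of_mem_edgeEnds : halfEdge e s '' Ioo 0 1 ⊆ C :=
  (image_halfEdge_Ioo_subset_openCell h.1).trans h.2.2

theorem image_halfEdge_Icc_of_mem_edgeEnds :
    halfEdge e s '' Icc 0 1 = insert w (insert (map 1 e 0) (halfEdge e s '' Ioo 0 1)) := by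
  rw [image_halfEdge_Icc, h.2.1]

theorem joinedIn_of_mem_edgeEnds : JoinedIn (halfEdge e s '' Icc 0 1) (map 1 e 0) w :=
  JoinedIn.ofLine (continuousOn_halfEdge h.1) (halfEdge_zero e s)
    ((halfEdge_one e s).trans h.2.1) Subset.rfl

end

variable [T2Space G] (hdim : ∀ m, 2 ≤ m → IsEmpty (cell (univ : Set G) m))

include hdim

theorem joinedIn_diff_of_mem_edgeEnds {C : Set G} {e e' : cell (univ : Set G) 1}
    {s s' : Fin 1 → ℝ} (hwC : w ∉ C) (hC : JoinedIn C (map 1 e 0) (map 1 e' 0))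
    (h : (e, s) ∈ edgeEnds w C) (h' : (e', s') ∈ edgeEnds w C) (hne : (e', s') ≠ (e, s)) :
    JoinedIn (insert w C \ halfEdge e s '' Ioo 0 1) (map 1 e 0) w := by
  have hdisj := disjoint_image_halfEdge_Icc_Ioo h.1 h'.1 hne
  have hmid : JoinedIn (C \ halfEdge e s '' Ioo 0 1) (map 1 e 0) (map 1 e' 0) := by
    refine joinedIn_diff_of_inter_frontier_subset_singleton hC
      (map_zero_notMem_image_halfEdge_Ioo h.1)
      (disjoint_left.1 hdisj (joinedIn_of_mem_edgeEnds h').source_mem) ?_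
    rintro x ⟨hxC, hx⟩
    rcases frontier_image_halfEdge_Ioo_subset h.1 hdim hx with hx | hx
    · exact hx
    · exact (hwC (h.2.1 ▸ hx ▸ hxC)).elim
  refine (hmid.mono (sdiff_subset_sdiff_left (subset_insert w C))).trans
    ((joinedIn_of_mem_edgeEnds h').mono (subset_sdiff.2 ⟨?_, hdisj⟩))
  rw [image_halfEdge_Icc_of_mem_edgeEnds h']
  exact insert_subset_insert <| insert_subset (map_zero_mem_of_mem_edgeEnds h')
    (image_halfEdge_Ioo_subset_of_mem_edgeEnds h')

variable (hw : IsVertex w)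

include hw

theorem frontier_subset_of_mem_doublyAttachedComponents {C : Set G}
    (hC : C ∈ doublyAttachedComponents w) : frontier C ⊆ {w} := by
  obtain ⟨⟨x, hx, rfl⟩, -⟩ := hC
  rw [connectedComponentIn_eq_pathComponentIn hdim hw hx]
  exact frontier_pathComponentIn_subset hdim hw x

theorem exists_evasionLoop {C : Set G} (hC : C ∈ doublyAttachedComponents w) :
    ∃ (L : EvasionLoop w C) (e : cell (univ : Set G) 1), L.base = map 1 e 0 := by
  obtain ⟨⟨x, hx, rfl⟩, hends⟩ := hC
  obtain ⟨⟨e, s⟩, ⟨e', s'⟩, h, h', hne⟩ := one_lt_encard_iff.1 (lt_of_lt_of_le (by norm_num) hends)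
  have hwC : w ∉ connectedComponentIn {w}ᶜ x := fun hw => connectedComponentIn_subset _ x hw rfl
  have hjoined : JoinedIn (connectedComponentIn {w}ᶜ x) (map 1 e 0) (map 1 e' 0) := by
    have hpc : IsPathConnected (connectedComponentIn {w}ᶜ x) := by
      rw [connectedComponentIn_eq_pathComponentIn hdim hw hx]
      exact isPathConnected_pathComponentIn hx
    exact hpc.joinedIn _ (map_zero_mem_of_mem_edgeEnds h) _ (map_zero_mem_of_mem_edgeEnds h')
  exact ⟨{
    base := map 1 e 0
    arm := halfEdge e s '' Ioo 0 1
    arm_subset := image_halfEdge_Ioo_subset_of_mem_edgeEnds h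
    frontier_arm_subset := h.2.1 ▸ frontier_image_halfEdge_Ioo_subset h.1 hdim
    joinedIn_escape := joinedIn_diff_of_mem_edgeEnds hdim hwC hjoined h h' hne.symm
    joinedIn_retreat := image_halfEdge_Icc_of_mem_edgeEnds h ▸ joinedIn_of_mem_edgeEnds h
  }, e, rfl⟩

end DoublyAttached

end GraphConf

theorem mainTheorem4_general {G : Type*} [TopologicalSpace G] [T2Space G]
    [CWComplex (Set.univ : Set G)]
    (hdim : ∀ m, 2 ≤ m → IsEmpty (RelCWComplex.cell (Set.univ : Set G) m)) {w : G}
    (hw : GraphConf.IsVertex w) {n : ℕ}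
    (hn : (n : ℕ∞) ≤ (GraphConf.doublyAttachedComponents w).encard) :
    (∃ f : GraphConf.Conf n G → G, GraphConf.IsIdentifyingFunction n G f) ∧
      ∃ s : GraphConf.Conf n G → GraphConf.Conf (n + 1) G, GraphConf.IsSection n G s := by
  obtain ⟨d, hd, hd1⟩ := GraphConf.exists_continuous_eq_zero_iff hdim hw
  obtain ⟨D, -⟩ := Fin.Embedding.exists_embedding_disjoint_range_of_add_le_ENat_card (s := ∅)
    (n := n) (α := GraphConf.doublyAttachedComponents w) (by simpa using hn)
  choose L e hL using fun i => GraphConf.exists_evasionLoop hdim hw (D i).2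
  obtain ⟨f, hf⟩ := GraphConf.exists_isIdentifyingFunction hd (D := fun i => (D i : Set G))
    (fun i j hij => GraphConf.pairwise_disjoint_doublyAttachedComponents (D i).2 (D j).2
      fun h => hij (D.injective (Subtype.ext h)))
    (fun i => GraphConf.frontier_subset_of_mem_doublyAttachedComponents hdim hw (D i).2) L
    fun i => (hL i).symm ▸ hd1 (e i)
  exact ⟨⟨f, hf⟩, hf.exists_isSection⟩

theorem mainTheorem4 {G : Type*} [TopologicalSpace G] [CWComplex (Set.univ : Set G)]
    (hG : GraphConf.IsGraph G) (w : G) (hw : GraphConf.IsVertex w) (n k : ℕ)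
    (hk : (k : ℕ∞) ≤ (GraphConf.doublyAttachedComponents w).encard) (hn : n ≤ k) :
    (∃ f : GraphConf.Conf n G → G, GraphConf.IsIdentifyingFunction n G f) ∧
      ∃ s : GraphConf.Conf n G → GraphConf.Conf (n + 1) G, GraphConf.IsSection n G s :=
  have := hG.t2
  mainTheorem4_general hG.dim_le_one hw ((Nat.cast_le.2 hn).trans hk)
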